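/- Let $G=(V,E)$ be a finite nonempty simple graph and let $s,s'\in\mathbb N\cup\{\infty\}$. In the cop and fast robber game on $G$, the cop chooses an initial vertex, then the robber chooses one; afterwards they move alternately with full information, the cop first. At his turn the cop stays or moves to a neighbour; the robber, at his turn, moves along a path (possibly of length $0$) of length at most $s$ that does not contain the vertex occupied by the cop. The cop wins if after finitely many moves he is at the same vertex as the robber. Write $G\in\mathcal{CWFR}(s)$ if the cop has a winning strategy, where a strategy may depend on all previous moves. Let $N_r(x)$ be the set of vertices joined to $x$ by a path of length at most $r$, and $N_r(x,G\setminus\{y\})$ the set of vertices joined to $x$ by such a path avoiding $y$. The graph $G$ is $(s,s')$-dismantlable if its vertices can be ordered $v_1,\dots,v_m$ so that for each $i<m$ there is $j>i$ with $N_s(v_i,G\setminus\{v_j\})\cap\{v_i,\dots,v_m\}\subseteq N_{s'}(v_j)$. A block of $G$ is a maximal connected subgraph without a cut vertex (so it is $2$-connected, a single edge, or an isolated vertex of $G$); two distinct blocks share at most one vertex. A vertex $u$ of a block $B$ dominates $B$ if it is adjacent to all other vertices of $B$. Call two distinct blocks adjacent if they share a vertex. If a block $R$ is chosen as root, a block $P$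 is the father of a block $B$ if $P$ and $B$ are adjacent and $B$ is one step farther from $R$ than $P$ in the resulting graph on the blocks. The graph $G$ is a big brother graph if this graph on the blocks is connected and a root $R$ can be chosen so that every block is dominated by one of its vertices and every block $B\ne R$ is dominated by the vertex that it shares with its father. Theorem. The following conditions are equivalent: (i) $G\in\mathcal{CWFR}(3)$; (i$'$) $G$ is $(3,1)$-dismantlable; (ii) $G\in\mathcal{CWFR}(\infty)$; (ii$'$) $G$ is $(\infty,1)$-dismantlable; (iii) $G$ is a big brother graph. In particular, for all $s,t\in\mathbb N\cup\{\infty\}$ with $s,t\ge 3$ one has $G\in\mathcal{CWFR}(s)$ if and only if $G\in\mathcal{CWFR}(t)$. -/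

import Mathlib

namespace FastRobber

variable {V : Type*}

/-- The ball `N_r(x)`: all vertices joined to `x` by a walk of length at most `r`. For `r = ∞`
this is the connected component of `x`. -/
def ball (G : SimpleGraph V) (r : ℕ∞) (x : V) : Set V :=
  {v | ∃ p : G.Walk x v, (p.length : ℕ∞) ≤ r}

/-- The punctured ball `N_r(x, G \ {y})`: all vertices joined to `x` by a walk of length at most
`r` that avoids `y`. -/
def puncturedBall (G : SimpleGraph V) (r : ℕ∞) (x y : V) : Set V :=
  {v | ∃ p : G.Walk x v, (p.length : ℕ∞) ≤ r ∧ y ∉ p.support}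

/-! ### The cop and fast robber game -/

/-- A strategy of a cop of speed `s'`. The history is the list of the pairs (cop position, robber
position) of the rounds played so far, latest round first; `next []` is the initial position of
the cop, and each later move goes along a walk of length at most `s'`. -/
structure CopStrategy (G : SimpleGraph V) (s' : ℕ∞) where
  next : List (V × V) → V
  legal : ∀ (c r : V) (h : List (V × V)), next ((c, r) :: h) ∈ ball G s' c

/-- The history of the first `n` rounds when the cop follows `σ` and the robber is at `r i` at the
end of round `i`. In each round the cop moves first. -/
def CopStrategy.history {G : SimpleGraph V} {s' : ℕ∞} (σ : CopStrategy G s') (r : ℕ → V) :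
    ℕ → List (V × V)
  | 0 => []
  | n + 1 => (σ.next (σ.history r n), r n) :: σ.history r n

/-- The position of the cop in round `n` (round `0` is the choice of the initial positions). -/
def CopStrategy.cop {G : SimpleGraph V} {s' : ℕ∞} (σ : CopStrategy G s') (r : ℕ → V) (n : ℕ) : V :=
  σ.next (σ.history r n)

/-- The robber, standing at `r n` at the end of round `n`, is captured by then or by the next move
of the cop. -/
def CopStrategy.Captured {G : SimpleGraph V} {s' : ℕ∞} (σ : CopStrategy G s') (r : ℕ → V)
    (n : ℕ) : Prop :=
  σ.cop r n = r n ∨ σ.cop r (n + 1) = r n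

/-- As long as he has not been captured, the robber moves along walks of length at most `s` that
avoid the current position of the cop. -/
def CopStrategy.LegalRobber {G : SimpleGraph V} {s' : ℕ∞} (σ : CopStrategy G s') (s : ℕ∞)
    (r : ℕ → V) : Prop :=
  ∀ n, (∀ m ≤ n, ¬ σ.Captured r m) → r (n + 1) ∈ puncturedBall G s (r n) (σ.cop r (n + 1))

/-- `G` belongs to the class `CWFR(s, s')`: a single cop of speed `s'` has a strategy that captures
a robber of speed `s` after finitely many moves, whatever the robber does. -/
def CWFR' (G : SimpleGraph V) (s s' : ℕ∞) : Prop :=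
  ∃ σ : CopStrategy G s', ∀ r : ℕ → V, σ.LegalRobber s r → ∃ n, σ.Captured r n

/-- `G` belongs to the class `CWFR(s) = CWFR(s, 1)`. -/
def CWFR (G : SimpleGraph V) (s : ℕ∞) : Prop := CWFR' G s 1

/-! ### Dismantlability -/

/-- `G` is `(s, s')`-dismantlable: its vertices can be ordered `v 0, …, v (m - 1)` so that for each
`i` but the last there is `j > i` with `N_s(v i, G \ {v j}) ∩ X_i ⊆ N_{s'}(v j)`, where
`X_i = {v i, …, v (m - 1)}`. -/
def Dismantlable (G : SimpleGraph V) (s s' : ℕ∞) : Prop :=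
  ∃ (m : ℕ) (v : Fin m ≃ V), ∀ i : Fin m, (i : ℕ) + 1 < m →
    ∃ j : Fin m, i < j ∧
      puncturedBall G s (v i) (v j) ∩ v '' Set.Ici i ⊆ ball G s' (v j)

/-! ### Blocks and big brother graphs -/

/-- The subgraph of `G` induced by `B` is connected and has no cut vertex. A single vertex and a
single edge qualify. -/
def Nonseparable (G : SimpleGraph V) (B : Set V) : Prop :=
  (G.induce B).Connected ∧ ∀ v ∈ B, (G.induce (B \ {v})).Preconnected

/-- A block of `G`, given by its vertex set (blocks are induced subgraphs). It is 2-connected, or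
a single edge, or an isolated vertex of `G`. -/
def IsBlock (G : SimpleGraph V) (B : Set V) : Prop := Maximal (Nonseparable G) B

/-- The type of blocks of `G`. -/
abbrev Block (G : SimpleGraph V) := {B : Set V // IsBlock G B}

/-- Two distinct blocks are adjacent when they share a vertex. -/
def blockGraph (G : SimpleGraph V) : SimpleGraph (Block G) where
  Adj B C := B ≠ C ∧ (B.1 ∩ C.1).Nonempty
  symm := ⟨fun _ _ h => ⟨h.1.symm, by rw [Set.inter_comm]; exact h.2⟩⟩
  loopless := ⟨fun _ h => h.1 rfl⟩

/-- In the block-decomposition rooted at `R`, built level by level from `R` by joining each labelled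
block to the not yet labelled blocks that meet it, `P` is the father of `B`. -/
def IsFather (G : SimpleGraph V) (R P B : Block G) : Prop :=
  (blockGraph G).Adj P B ∧ (blockGraph G).dist R B = (blockGraph G).dist R P + 1

/-- The vertex `u` of `B` is adjacent to all other vertices of `B`. -/
def Dominates (G : SimpleGraph V) (u : V) (B : Set V) : Prop :=
  u ∈ B ∧ ∀ v ∈ B, v ≠ u → G.Adj u v

/-- `G` is a big brother graph: its blocks form a tree rooted at some block `R` (so that every block
is reached from `R`), each block is dominated by one of its vertices, and each block `B ≠ R` is
dominated by the articulation point that it shares with its father. -/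
def IsBigBrother (G : SimpleGraph V) : Prop :=
  (blockGraph G).Connected ∧ (∀ B : Block G, ∃ u, Dominates G u B.1) ∧
    ∃ R : Block G, ∀ P B : Block G, IsFather G R P B →
      ∃ a, P.1 ∩ B.1 = {a} ∧ Dominates G a B.1

end FastRobber

namespace FastRobber

variable {V : Type*}

/-! ### Balls -/

/-! The conditions are linked in one cycle: cop wins at speed 3, (3,1)-dismantlable, big brother,
(∞,1)-dismantlable, cop wins at speed ∞, and back because a slower robber has fewer moves.

Game and dismantlability are compared through shadows, for any speed at least 1. If every deletion
process gets stuck on a set with two or more vertices, the deletions made so far compose to a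
retraction, and the robber escapes by staying away from the retracted image of the cop
(`not_cwfr_of_isRetraction`). Conversely, when `y` dominates `x`, a cop who wins without `x` also
wins with it by treating a robber at `x` as if he stood at `y` (`CopWins.of_shadow`).

The jump from 3 to ∞ is structural and passes through sibling trees: rooted spanning trees whose
non-tree edges all join siblings. Reinserting the deleted vertices of a (3,1)-dismantling preserves
such a tree, either by hanging a leaf or by moving the root (`DismantlableSet.exists_siblingTree`).
In a sibling tree a robber cut off by `y` stays among the descendants of `y` however fast he is, so
deepest vertices can be deleted at any speed (`IsSiblingTree.dismantlableSet`). Sibling trees are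
also the big brother graphs: a block is a top vertex with some of its children, and conversely the
parent of a vertex is the chosen dominating vertex of its block nearest the root
(`IsSiblingTree.isBigBrother`, `IsBigBrother.exists_siblingTree`). -/

theorem mem_ball_one {G : SimpleGraph V} {x v : V} : v ∈ ball G 1 x ↔ v = x ∨ G.Adj x v := by
  constructor
  · rintro ⟨p, hp⟩
    have hp : p.length ≤ 1 := by exact_mod_cast hp
    cases p with
    | nil => exact Or.inl rfl
    | cons h q =>
      cases q with
      | nil => exact Or.inr h
      | cons h' q' => simp at hp
  · rintro (rfl | h)
    · exact ⟨.nil, by simp⟩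
    · exact ⟨h.toWalk, by simp⟩

theorem mem_puncturedBall_self {G : SimpleGraph V} {s : ℕ∞} {x y : V} (h : x ≠ y) :
    x ∈ puncturedBall G s x y :=
  ⟨.nil, by simp, by simpa using h.symm⟩

theorem mem_puncturedBall_of_adj {G : SimpleGraph V} {s : ℕ∞} (hs : 1 ≤ s) {x y v : V}
    (h : G.Adj x v) (hx : x ≠ y) (hv : v ≠ y) : v ∈ puncturedBall G s x y :=
  ⟨h.toWalk, by simpa using hs, by simp [hx.symm, hv.symm]⟩

theorem puncturedBall_mono {G : SimpleGraph V} {s t : ℕ∞} (h : s ≤ t) (x y : V) :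
    puncturedBall G s x y ⊆ puncturedBall G t x y :=
  fun _ ⟨p, hp, hy⟩ => ⟨p, hp.trans h, hy⟩

theorem mem_puncturedBall_comm {G : SimpleGraph V} {s : ℕ∞} {x y z : V} :
    z ∈ puncturedBall G s x y ↔ x ∈ puncturedBall G s z y :=
  ⟨fun ⟨p, hp, hy⟩ => ⟨p.reverse, by simpa using hp, by simpa using hy⟩,
    fun ⟨p, hp, hy⟩ => ⟨p.reverse, by simpa using hp, by simpa using hy⟩⟩

theorem ne_of_mem_puncturedBall {G : SimpleGraph V} {s : ℕ∞} {x y z : V}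
    (h : z ∈ puncturedBall G s x y) : z ≠ y := by
  obtain ⟨p, -, hy⟩ := h
  rintro rfl
  exact hy p.end_mem_support

/-- A walk that avoids `y` either avoids `w` too, or can be started at `w`. -/
theorem puncturedBall_avoid_or {G : SimpleGraph V} {s : ℕ∞} {x y z : V} (w : V)
    (h : z ∈ puncturedBall G s x y) :
    z ∈ puncturedBall G s x w ∨ z ∈ puncturedBall G s w y := by
  classical
  obtain ⟨p, hp, hy⟩ := h
  by_cases hw : w ∈ p.support
  · refine Or.inr ⟨p.dropUntil w hw, le_trans ?_ hp, fun h => hy (p.support_dropUntil_subset_support hw h)⟩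
    exact_mod_cast p.length_dropUntil_le_length hw
  · exact Or.inl ⟨p, hp, hw⟩

/-! ### Dismantling sets of vertices -/

/-- The vertices of `X` can be deleted one by one, each deleted vertex `x` being dominated by a
remaining vertex `y`, until a single vertex is left. -/
inductive DismantlableSet (G : SimpleGraph V) (s : ℕ∞) : Set V → Prop
  | singleton (x : V) : DismantlableSet G s {x}
  | delete {X : Set V} {x y : V} (hx : x ∈ X) (hy : y ∈ X) (hxy : x ≠ y)
      (h : puncturedBall G s x y ∩ X ⊆ ball G 1 y) (hX : DismantlableSet G s (X \ {x})) :
      DismantlableSet G s X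

theorem DismantlableSet.exists_order {G : SimpleGraph V} {s : ℕ∞} {X : Set V}
    (h : DismantlableSet G s X) :
    ∃ (m : ℕ) (v : Fin m → V), Function.Injective v ∧ Set.range v = X ∧
      ∀ i : Fin m, (i : ℕ) + 1 < m → ∃ j, i < j ∧
        ∀ k, i ≤ k → v k ∈ puncturedBall G s (v i) (v j) → v k ∈ ball G 1 (v j) := by
  induction h with
  | singleton x =>
    refine ⟨1, fun _ => x, Function.injective_of_subsingleton _, by simp, fun i hi => ?_⟩
    omega
  | @delete X x y hx hy hxy h hX ih =>
    obtain ⟨m, v, hinj, hrange, hv⟩ := ih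
    have hmem : ∀ k, v k ∈ X \ {x} := fun k => hrange ▸ Set.mem_range_self k
    refine ⟨m + 1, Fin.cons x v, ?_, ?_, ?_⟩
    · rw [Fin.cons_injective_iff]
      exact ⟨by rw [hrange]; simp, hinj⟩
    · rw [Fin.range_cons, hrange, Set.insert_sdiff_singleton, Set.insert_eq_of_mem hx]
    · intro i
      refine Fin.cases ?_ ?_ i
      · intro _
        obtain ⟨j, hj⟩ : y ∈ Set.range v := by rw [hrange]; exact ⟨hy, hxy.symm⟩
        refine ⟨j.succ, Fin.succ_pos j, fun k _ hk => ?_⟩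
        simp only [Fin.cons_zero, Fin.cons_succ, hj] at hk ⊢
        refine h ⟨hk, ?_⟩
        refine Fin.cases ?_ (fun k => ?_) k
        · simpa using hx
        · simpa using (hmem k).1
      · intro i hi
        obtain ⟨j, hij, hj⟩ := hv i (by simpa using hi)
        refine ⟨j.succ, Fin.succ_lt_succ_iff.2 hij, fun k => ?_⟩
        refine Fin.cases (fun hk => ?_) (fun k hk => ?_) k
        · exact absurd hk (by simp)
        · simpa using hj k (Fin.succ_le_succ_iff.1 hk)

theorem DismantlableSet.dismantlable {G : SimpleGraph V} {s : ℕ∞}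
    (h : DismantlableSet G s Set.univ) : Dismantlable G s 1 := by
  obtain ⟨m, v, hinj, hrange, hv⟩ := h.exists_order
  refine ⟨m, Equiv.ofBijective v ⟨hinj, Set.range_eq_univ.1 hrange⟩, fun i hi => ?_⟩
  obtain ⟨j, hij, hj⟩ := hv i hi
  refine ⟨j, hij, ?_⟩
  rintro _ ⟨hz, k, hk, rfl⟩
  exact hj k hk hz

theorem Dismantlable.dismantlableSet [Nonempty V] {G : SimpleGraph V} {s : ℕ∞}
    (h : Dismantlable G s 1) : DismantlableSet G s Set.univ := by
  obtain ⟨m, v, hv⟩ := h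
  have hm : 0 < m := Fin.pos (v.symm (Classical.arbitrary V))
  have key : ∀ n (i : Fin m), (i : ℕ) + 1 + n = m → DismantlableSet G s (v '' Set.Ici i) := by
    intro n
    induction n with
    | zero =>
      intro i hi
      have : Set.Ici i = {i} := by
        ext k
        simp only [Set.mem_Ici, Set.mem_singleton_iff, Fin.le_def, Fin.ext_iff]
        omega
      rw [this, Set.image_singleton]
      exact .singleton _
    | succ n ih =>
      intro i hi
      obtain ⟨j, hij, hj⟩ := hv i (by omega)
      refine .delete ⟨i, Set.self_mem_Ici, rfl⟩ ⟨j, hij.le, rfl⟩ (v.injective.ne hij.ne) hj ?_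
      have : v '' Set.Ici i \ {v i} = v '' Set.Ici (⟨i + 1, by omega⟩ : Fin m) := by
        rw [← Set.image_singleton, ← Set.image_sdiff v.injective]
        congr 1
        ext k
        simp only [Set.mem_sdiff, Set.mem_Ici, Set.mem_singleton_iff, Fin.le_def, Fin.ext_iff]
        omega
      rw [this]
      exact ih _ (by simp; omega)
  have := key (m - 1) ⟨0, hm⟩ (by simp; omega)
  have h0 : Set.Ici (⟨0, hm⟩ : Fin m) = Set.univ := by
    ext k
    simp [Fin.le_def]
  rwa [h0, Set.image_univ, v.range_eq_univ] at this

/-! ### From dismantlability to a strategy of the cop -/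

/-- The cop at `c`, to move, captures a robber at `r` who always ends his moves in `X` within `n`
further rounds. -/
def CopWins (G : SimpleGraph V) (s : ℕ∞) (X : Set V) : ℕ → V → V → Prop
  | 0, c, r => r ∈ ball G 1 c
  | n + 1, c, r => CopWins G s X n c r ∨
      ∃ c' ∈ ball G 1 c, ∀ r' ∈ puncturedBall G s r c' ∩ X, CopWins G s X n c' r'

theorem CopWins.mono {G : SimpleGraph V} {s : ℕ∞} {X : Set V} {m n : ℕ} (h : m ≤ n) {c r : V}
    (hw : CopWins G s X m c r) : CopWins G s X n c r := by
  induction n, h using Nat.le_induction with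
  | base => exact hw
  | succ n _ ih => exact Or.inl ih

open Classical in
/-- If `y` dominates `x`, the cop may chase the robber's shadow, which is `y` when the robber is
at `x`. -/
theorem CopWins.of_shadow {G : SimpleGraph V} {s : ℕ∞} (hs : 1 ≤ s) {X : Set V} {x y : V}
    (hx : x ∈ X) (hy : y ∈ X) (hxy : x ≠ y) (h : puncturedBall G s x y ∩ X ⊆ ball G 1 y) :
    ∀ (n : ℕ) (c r : V), r ∈ X → CopWins G s (X \ {x}) n c (if r = x then y else r) →
      CopWins G s X (n + 1) c r := by
  have hxb : x ∈ ball G 1 y := h ⟨mem_puncturedBall_self hxy, hx⟩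
  intro n
  induction n with
  | zero =>
    intro c r _ hw
    split_ifs at hw with hr
    · subst hr
      -- This is the extra round: the cop takes the shadow at `y`, and every answer of the robber
      -- from `x` ends within reach.
      exact Or.inr ⟨y, hw, fun r' hr' => h hr'⟩
    · exact Or.inl hw
  | succ n ih =>
    rintro c r hr (hw | ⟨c', hc', hw⟩)
    · exact Or.inl (ih c r hr hw)
    refine Or.inr ⟨c', hc', fun r' ⟨hr', hr'X⟩ => ?_⟩
    have of_ball : r' ∈ ball G 1 c' → CopWins G s X (n + 1) c' r' :=
      fun hb => CopWins.mono (m := 0) (Nat.zero_le _) hb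
    have hr'c := ne_of_mem_puncturedBall hr'
    -- With the cop on `y` the shadow rule breaks down, but a robber who starts or ends his move at
    -- `x` then finishes in the closed neighbourhood of `y` and is caught at once.
    by_cases hcy : c' = y
    · subst hcy
      by_cases hr'x : r' = x
      · exact of_ball (hr'x ▸ hxb)
      by_cases hrx : r = x
      · exact of_ball (h ⟨hrx ▸ hr', hr'X⟩)
      · refine ih _ _ hr'X (hw _ ?_)
        simp only [hr'x, hrx, if_false]
        exact ⟨hr', hr'X, hr'x⟩
    · refine ih _ _ hr'X (hw _ ?_)
      -- A robber's walk from `x` either meets `y`, whose tail the shadow can follow, or avoids `y`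
      -- and ends at `y` or a neighbour, which the shadow reaches in one step.
      have step : ∀ z, z ∈ X → z ≠ c' → z ∈ puncturedBall G s x c' →
          z ∈ puncturedBall G s y c' := by
        intro z hzX hzc hz
        rcases puncturedBall_avoid_or y hz with hz | hz
        · rcases mem_ball_one.1 (h ⟨hz, hzX⟩) with rfl | hadj
          · exact mem_puncturedBall_self hzc
          · exact mem_puncturedBall_of_adj hs hadj (Ne.symm hcy) hzc
        · exact hz
      by_cases hr'x : r' = x <;> by_cases hrx : r = x
      · simp only [hr'x, hrx, if_true]
        exact ⟨mem_puncturedBall_self (Ne.symm hcy), hy, hxy.symm⟩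
      · simp only [hr'x, hrx, if_true, if_false]
        subst hr'x
        have hrc : r ≠ c' := by
          rintro rfl
          exact ne_of_mem_puncturedBall (mem_puncturedBall_comm.1 hr') rfl
        exact ⟨mem_puncturedBall_comm.1 (step r hr hrc (mem_puncturedBall_comm.1 hr')), hy,
          hxy.symm⟩
      · simp only [hr'x, hrx, if_true, if_false]
        subst hrx
        exact ⟨step r' hr'X hr'c hr', hr'X, hr'x⟩
      · simp only [hr'x, hrx, if_false]
        exact ⟨hr', hr'X, hr'x⟩

theorem DismantlableSet.exists_copWins {G : SimpleGraph V} {s : ℕ∞} (hs : 1 ≤ s) {X : Set V}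
    (h : DismantlableSet G s X) : ∃ n c, ∀ r ∈ X, CopWins G s X n c r := by
  classical
  induction h with
  | singleton x => exact ⟨0, x, fun r hr => mem_ball_one.2 (Or.inl hr)⟩
  | @delete X x y hx hy hxy h hX ih =>
    obtain ⟨n, c, hc⟩ := ih
    refine ⟨n + 1, c, fun r hr => CopWins.of_shadow hs hx hy hxy h n c r hr (hc _ ?_)⟩
    split_ifs with hrx
    · exact ⟨hy, hxy.symm⟩
    · exact ⟨hr, hrx⟩

/-- In every position the cop has a move that is good for every number of remaining rounds. -/
theorem exists_uniform_move (G : SimpleGraph V) (s : ℕ∞) (c r : V) :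
    ∃ c' ∈ ball G 1 c, (r ∈ ball G 1 c → c' = r) ∧
      ∀ n, CopWins G s Set.univ (n + 1) c r → r ∉ ball G 1 c →
        ∀ r' ∈ puncturedBall G s r c', CopWins G s Set.univ n c' r' := by
  classical
  by_cases hb : r ∈ ball G 1 c
  · exact ⟨r, hb, fun _ => rfl, fun _ _ h => absurd hb h⟩
  by_cases hw : ∃ n, CopWins G s Set.univ n c r
  -- The move that wins in the least number of rounds also serves every larger bound.
  · obtain ⟨N, hN⟩ : ∃ N, Nat.find hw = N := ⟨_, rfl⟩
    have hspec := Nat.find_spec hw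
    rw [hN] at hspec
    cases N with
    | zero => exact absurd hspec hb
    | succ N =>
      rcases hspec with hspec | ⟨c', hc', hspec⟩
      · exact absurd hspec (Nat.find_min hw (by omega))
      · refine ⟨c', hc', fun h => absurd h hb, fun n hn _ r' hr' => ?_⟩
        have : N ≤ n := by
          have := Nat.find_min' hw hn
          omega
        exact (hspec r' ⟨hr', trivial⟩).mono this
  · exact ⟨c, mem_ball_one.2 (Or.inl rfl), fun h => absurd h hb, fun n hn => absurd ⟨_, hn⟩ hw⟩

theorem cwfr_of_copWins {G : SimpleGraph V} {s : ℕ∞} {n : ℕ} {c : V}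
    (h : ∀ r, CopWins G s Set.univ n c r) : CWFR G s := by
  choose move hmove hcapt hwin using exists_uniform_move G s
  let next : List (V × V) → V
    | [] => c
    | (c', r') :: _ => move c' r'
  refine ⟨⟨next, fun c' r' _ => hmove c' r'⟩, fun r hr => ?_⟩
  set σ : CopStrategy G 1 := ⟨next, fun c' r' _ => hmove c' r'⟩
  by_contra hnot
  push Not at hnot
  have hsucc : ∀ k, σ.cop r (k + 1) = move (σ.cop r k) (r k) := fun k => rfl
  -- If the robber is never captured, each good move would pass a winning position on with one round
  -- fewer, down to an immediate capture.
  have key : ∀ n k, ¬ CopWins G s Set.univ n (σ.cop r k) (r k) := by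
    intro n
    induction n with
    | zero => exact fun k hk => hnot k (Or.inr ((hsucc k).trans (hcapt _ _ hk)))
    | succ n ih =>
      intro k hk
      by_cases hb : r k ∈ ball G 1 (σ.cop r k)
      · exact hnot k (Or.inr ((hsucc k).trans (hcapt _ _ hb)))
      · refine ih (k + 1) ?_
        rw [hsucc]
        refine hwin _ _ n hk hb _ ?_
        rw [← hsucc]
        exact hr k fun m _ => hnot m
  exact key n 0 (h (r 0))

theorem Dismantlable.cwfr [Nonempty V] {G : SimpleGraph V} {s : ℕ∞} (hs : 1 ≤ s)
    (h : Dismantlable G s 1) : CWFR G s := by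
  obtain ⟨n, c, hc⟩ := h.dismantlableSet.exists_copWins hs
  exact cwfr_of_copWins fun r => hc r trivial

theorem CWFR.anti {G : SimpleGraph V} {s t : ℕ∞} (hst : s ≤ t) (h : CWFR G t) : CWFR G s := by
  obtain ⟨σ, hσ⟩ := h
  exact ⟨σ, fun r hr => hσ r fun n hn => puncturedBall_mono hst _ _ (hr n hn)⟩

/-! ### From a strategy of the cop to dismantlability -/

/-- `f` retracts `G` onto the set `X` that is left of `G` after some deletions. -/
structure IsRetraction (G : SimpleGraph V) (s : ℕ∞) (X : Set V) (f : V → V) : Prop where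
  mem : ∀ v, f v ∈ X
  fixed : ∀ v ∈ X, f v = v
  adj : ∀ v w, G.Adj v w → f v ∈ ball G 1 (f w)
  dominated : ∀ v, puncturedBall G s v (f v) ∩ X ⊆ ball G 1 (f v)

theorem IsRetraction.mem_ball {G : SimpleGraph V} {s : ℕ∞} {X : Set V} {f : V → V}
    (h : IsRetraction G s X f) {v w : V} (hv : v ∈ ball G 1 w) : f v ∈ ball G 1 (f w) := by
  rcases mem_ball_one.1 hv with rfl | hv
  · exact mem_ball_one.2 (Or.inl rfl)
  · exact h.adj v w hv.symm

theorem mem_ball_one_comm {G : SimpleGraph V} {v w : V} : v ∈ ball G 1 w ↔ w ∈ ball G 1 v := by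
  simp only [mem_ball_one, G.adj_comm, eq_comm]

open Classical in
-- Compose with the fold of `x` onto `y`. If `f v = x`, a walk from `v` avoiding `y` either avoids
-- `x`, so ends near `x` and hence near `y`, or has a tail from `x` to which the domination of `x`
-- by `y` applies.
theorem IsRetraction.delete {G : SimpleGraph V} {s : ℕ∞} (hs : 1 ≤ s) {X : Set V} {f : V → V}
    (hf : IsRetraction G s X f) {x y : V} (hy : y ∈ X) (hxy : x ≠ y)
    (h : puncturedBall G s x y ∩ X ⊆ ball G 1 y) :
    IsRetraction G s (X \ {x}) fun v => if f v = x then y else f v := by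
  have near : ∀ z ∈ X, z ∈ ball G 1 x → z ∈ ball G 1 y := by
    intro z hz hzx
    by_cases hzy : z = y
    · exact mem_ball_one.2 (Or.inl hzy)
    rcases mem_ball_one.1 hzx with rfl | hadj
    · exact h ⟨mem_puncturedBall_self hxy, hz⟩
    · exact h ⟨mem_puncturedBall_of_adj hs hadj hxy hzy, hz⟩
  refine ⟨fun v => ?_, fun v hv => ?_, fun v w hvw => ?_, fun v => ?_⟩
  · split_ifs with hv
    · exact ⟨hy, hxy.symm⟩
    · exact ⟨hf.mem v, hv⟩
  · rw [hf.fixed v hv.1, if_neg (by simpa using hv.2)]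
  · have hadj := hf.adj v w hvw
    split_ifs with hw hv hv
    · exact mem_ball_one.2 (Or.inl rfl)
    · rw [hw] at hadj
      exact near _ (hf.mem v) hadj
    · rw [hv] at hadj
      exact mem_ball_one_comm.1 (near _ (hf.mem w) (mem_ball_one_comm.1 hadj))
    · exact hadj
  · split_ifs with hv
    · rintro z ⟨hz, hzX, -⟩
      rcases puncturedBall_avoid_or x hz with hz | hz
      · rw [← hv] at hz near
        exact near z hzX (hf.dominated v ⟨hz, hzX⟩)
      · exact h ⟨hz, hzX⟩
    · exact fun z ⟨hz, hzX, _⟩ => hf.dominated v ⟨hz, hzX⟩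

/-- The play of a robber who answers a position (robber at `r`, cop moved to `c`) by `reply r c`,
starting at `start`: the history of rounds, latest first, after round `n`. -/
def CopStrategy.playAgainst {G : SimpleGraph V} {s' : ℕ∞} (σ : CopStrategy G s') (start : V)
    (reply : V → V → V) : ℕ → (V × V) × List (V × V)
  | 0 => ((σ.next [], start), [])
  | n + 1 =>
    let p := σ.playAgainst start reply n
    let c := σ.next (p.1 :: p.2)
    ((c, reply p.1.2 c), p.1 :: p.2)

/-- Cop and robber answer each other, and the cop sees the whole past, so the recursion has to carry
complete histories. -/
theorem CopStrategy.exists_play {G : SimpleGraph V} {s' : ℕ∞} (σ : CopStrategy G s') (start : V)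
    (reply : V → V → V) :
    ∃ r : ℕ → V, r 0 = start ∧ ∀ n, r (n + 1) = reply (r n) (σ.cop r (n + 1)) := by
  refine ⟨fun n => (σ.playAgainst start reply n).1.2, rfl, fun n => ?_⟩
  have hist : ∀ n, σ.history (fun n => (σ.playAgainst start reply n).1.2) (n + 1) =
      (σ.playAgainst start reply n).1 :: (σ.playAgainst start reply n).2 := by
    intro n
    induction n with
    | zero => rfl
    | succ n ih =>
      rw [CopStrategy.history, ih]
      rfl
  rw [CopStrategy.cop, hist]
  rfl

/-- If nothing can be deleted from `X`, the robber escapes inside `X`. -/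
theorem not_cwfr_of_isRetraction {G : SimpleGraph V} {s : ℕ∞} {X : Set V} {f : V → V}
    (hf : IsRetraction G s X f) (hX : X.Nontrivial)
    (h : ∀ x ∈ X, ∀ y ∈ X, x ≠ y → ¬ puncturedBall G s x y ∩ X ⊆ ball G 1 y) : ¬ CWFR G s := by
  rintro ⟨σ, hσ⟩
  have hreply : ∀ x c, ∃ z, x ∈ X → x ≠ f c →
      z ∈ puncturedBall G s x (f c) ∧ z ∈ X ∧ z ∉ ball G 1 (f c) := by
    intro x c
    by_cases hxc : x ∈ X ∧ x ≠ f c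
    · obtain ⟨z, hz, hzb⟩ := Set.not_subset.1 (h x hxc.1 _ (hf.mem c) hxc.2)
      exact ⟨z, fun _ _ => ⟨hz.1, hz.2, hzb⟩⟩
    · exact ⟨x, fun h₁ h₂ => absurd ⟨h₁, h₂⟩ hxc⟩
  choose reply hreply using hreply
  obtain ⟨x₀, hx₀, hx₀c⟩ := hX.exists_ne (f (σ.next []))
  -- A reply from an arbitrary `x₀` off the shadow supplies a starting vertex at distance at least 2
  -- from it.
  obtain ⟨r, hr0, hrs⟩ := σ.exists_play (reply x₀ (σ.next [])) reply
  have hcop : ∀ n, σ.cop r (n + 1) ∈ ball G 1 (σ.cop r n) := fun n => σ.legal _ _ _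
  have shadow_ne : ∀ n, r n ∈ X → r n ∉ ball G 1 (f (σ.cop r n)) →
      r n ≠ f (σ.cop r (n + 1)) := fun n _ hn he => hn (he ▸ hf.mem_ball (hcop n))
  have inv : ∀ n, r n ∈ X ∧ r n ∉ ball G 1 (f (σ.cop r n)) := by
    intro n
    induction n with
    | zero =>
      rw [hr0]
      exact (hreply x₀ _ hx₀ hx₀c).2
    | succ n ih =>
      rw [hrs n]
      exact (hreply _ _ ih.1 (shadow_ne n ih.1 ih.2)).2
  obtain ⟨n, hn⟩ := hσ r fun n _ => by
    obtain ⟨h₁, h₂, h₃⟩ := hreply _ _ (inv n).1 (shadow_ne n (inv n).1 (inv n).2)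
    rw [hrs n]
    -- The reply avoids the shadow; if it ran through the cop himself, its tail would start at the
    -- cop, and `dominated` would put its end next to the shadow.
    rcases puncturedBall_avoid_or (σ.cop r (n + 1)) h₁ with h₄ | h₄
    · exact h₄
    · exact absurd (hf.dominated _ ⟨h₄, h₂⟩) h₃
  have := hf.fixed _ (inv n).1
  rcases hn with hn | hn
  · refine (inv n).2 (mem_ball_one.2 (Or.inl ?_))
    rw [hn, this]
  · exact shadow_ne n (inv n).1 (inv n).2 (by rw [hn, this])

theorem IsRetraction.dismantlableSet [Finite V] {G : SimpleGraph V} {s : ℕ∞} (hs : 1 ≤ s)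
    (hG : CWFR G s) : ∀ (n : ℕ) (X : Set V) (f : V → V), X.ncard = n → X.Nonempty →
      IsRetraction G s X f → DismantlableSet G s X := by
  intro n
  induction n with
  | zero =>
    intro X f hn hX
    exact absurd ((Set.ncard_eq_zero).1 hn) hX.ne_empty
  | succ n ih =>
    intro X f hn hX hf
    rcases hX.exists_eq_singleton_or_nontrivial with ⟨x, rfl⟩ | hX
    · exact .singleton x
    by_contra hnot
    refine not_cwfr_of_isRetraction hf hX (fun x hx y hy hxy h => hnot ?_) hG
    refine .delete hx hy hxy h (ih _ _ ?_ ⟨y, hy, hxy.symm⟩ (hf.delete hs hy hxy h))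
    rw [Set.ncard_sdiff_singleton_of_mem hx, hn, Nat.add_sub_cancel]

theorem CWFR.dismantlable [Finite V] [Nonempty V] {G : SimpleGraph V} {s : ℕ∞} (hs : 1 ≤ s)
    (hG : CWFR G s) : Dismantlable G s 1 := by
  refine (IsRetraction.dismantlableSet hs hG _ Set.univ id rfl Set.univ_nonempty
    ⟨fun _ => trivial, fun _ _ => rfl, fun v w h => mem_ball_one.2 (Or.inr h.symm), ?_⟩).dismantlable
  -- For the identity, `dominated` is vacuous: no walk from `v` avoids `v`.
  rintro v z ⟨⟨p, -, hv⟩, -⟩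
  exact absurd p.start_mem_support hv

/-! ### Sibling trees -/

/-- A spanning tree of the subgraph induced by `X`, with root `u` and parent function `d`, such that
every other edge joins two siblings. The function `ρ` witnesses that `d` leads to the root. -/
structure IsSiblingTree (G : SimpleGraph V) (X : Set V) (u : V) (d : V → V) (ρ : V → ℕ) : Prop where
  root_mem : u ∈ X
  parent_root : d u = u
  parent_mem : ∀ v ∈ X, d v ∈ X
  adj_parent : ∀ v ∈ X, v ≠ u → G.Adj v (d v)
  rank_lt : ∀ v ∈ X, v ≠ u → ρ (d v) < ρ v
  edge : ∀ v ∈ X, ∀ w ∈ X, G.Adj v w → v = d w ∨ w = d v ∨ d v = d w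

open Classical in
/-- The new vertex `x` becomes a child of `y`. -/
theorem IsSiblingTree.insert_leaf {G : SimpleGraph V} {X : Set V} {u x y : V} {d : V → V}
    {ρ : V → ℕ} (hT : IsSiblingTree G (X \ {x}) u d ρ) (hx : x ∈ X) (hy : y ∈ X) (hxy : G.Adj x y)
    (h : ∀ p ∈ X, G.Adj x p → p = y ∨ d p = y) :
    IsSiblingTree G X u (Function.update d x y) (Function.update ρ x (ρ y + 1)) := by
  have hyx : y ≠ x := hxy.ne'
  have hux : u ≠ x := hT.root_mem.2
  have old : ∀ v ∈ X, v ≠ x → Function.update d x y v = d v :=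
    fun v _ hvx => Function.update_of_ne hvx _ _
  refine ⟨hT.root_mem.1, ?_, ?_, ?_, ?_, ?_⟩
  · rw [Function.update_of_ne hux, hT.parent_root]
  · intro v hv
    by_cases hvx : v = x
    · simpa [hvx] using hy
    · rw [old v hv hvx]
      exact (hT.parent_mem v ⟨hv, hvx⟩).1
  · intro v hv hvu
    by_cases hvx : v = x
    · simpa [hvx] using hxy
    · rw [old v hv hvx]
      exact hT.adj_parent v ⟨hv, hvx⟩ hvu
  · intro v hv hvu
    by_cases hvx : v = x
    · simp [hvx, Function.update_of_ne hyx]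
    · rw [old v hv hvx, Function.update_of_ne hvx,
        Function.update_of_ne (hT.parent_mem v ⟨hv, hvx⟩).2]
      exact hT.rank_lt v ⟨hv, hvx⟩ hvu
  · have new : ∀ w ∈ X, G.Adj x w → w = Function.update d x y x ∨
        Function.update d x y x = Function.update d x y w := by
      intro w hw hxw
      rw [old w hw hxw.ne', Function.update_self]
      exact (h w hw hxw).imp_right Eq.symm
    intro v hv w hw hvw
    by_cases hvx : v = x
    · subst hvx
      exact Or.inr (new w hw hvw)
    by_cases hwx : w = x
    · subst hwx
      rcases new v hv hvw.symm with h | h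
      · exact Or.inl h
      · exact Or.inr (Or.inr h.symm)
    rw [old v hv hvx, old w hw hwx]
    exact hT.edge v ⟨hv, hvx⟩ w ⟨hw, hwx⟩ hvw

open Classical in
/-- The new vertex `x` becomes a child of `y`, which takes the place of the root. -/
theorem IsSiblingTree.insert_reroot {G : SimpleGraph V} {X : Set V} {u x y : V} {d : V → V}
    {ρ : V → ℕ} (hT : IsSiblingTree G (X \ {x}) u d ρ) (hy : y ∈ X) (hxy : G.Adj x y)
    (hyu : y ≠ u) (hdy : d y = u) (hchild : ∀ q ∈ X, q ≠ x → d q = u → q ≠ y → G.Adj q y)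
    (h : ∀ p ∈ X, G.Adj x p → p = y ∨ G.Adj y p) :
    IsSiblingTree G X y (fun v => if v = x ∨ d v = u then y else d v)
      (fun v => if v = y then 0 else if v = x ∨ d v = u then 1 else ρ v + 2) := by
  have hyx : y ≠ x := hxy.ne'
  -- As `d u = u`, the clause `d v = u` also turns the old root into a child of `y`. The shift by 2
  -- makes room for the new root and its children and keeps the old order elsewhere.
  refine ⟨hy, by simp [hdy], ?_, ?_, ?_, ?_⟩
  · intro v hv
    split_ifs with hc
    · exact hy
    · exact (hT.parent_mem v ⟨hv, fun hvx => hc (Or.inl hvx)⟩).1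
  · intro v hv hvy
    split_ifs with hc
    · by_cases hvx : v = x
      · exact hvx ▸ hxy
      · exact hchild v hv hvx (hc.resolve_left hvx) hvy
    · push Not at hc
      refine hT.adj_parent v ⟨hv, hc.1⟩ ?_
      rintro rfl
      exact hc.2 hT.parent_root
  · intro v hv hvy
    rw [if_neg hvy]
    by_cases hc : v = x ∨ d v = u
    · simp [hc]
    · rw [if_neg hc, if_neg hc]
      push Not at hc
      have : ρ (d v) < ρ v := by
        refine hT.rank_lt v ⟨hv, hc.1⟩ ?_
        rintro rfl
        exact hc.2 hT.parent_root
      split_ifs <;> omega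
  · have new : ∀ w ∈ X, G.Adj x w → w = y ∨ (if w = x ∨ d w = u then y else d w) = y := by
      intro w hw hxw
      rcases h w hw hxw with rfl | hyw
      · exact Or.inl rfl
      right
      have hwx := hxw.ne'
      rcases hT.edge y ⟨hy, hyx⟩ w ⟨hw, hwx⟩ hyw with h | h | h
      · split_ifs
        · rfl
        · exact h.symm
      · rw [if_pos]
        right
        rw [h, hdy, hT.parent_root]
      · rw [if_pos]
        right
        rw [← h, hdy]
    intro v hv w hw hvw
    by_cases hvx : v = x
    · subst hvx
      rcases new w hw hvw with h | h
      · simp [h]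
      · simp [h]
    by_cases hwx : w = x
    · subst hwx
      rcases new v hv hvw.symm with h | h
      · simp [h]
      · simp [h]
    simp only [hvx, hwx, false_or]
    rcases hT.edge v ⟨hv, hvx⟩ w ⟨hw, hwx⟩ hvw with h | h | h
    · by_cases hu : d w = u
      · rw [hu] at h
        simp [h, hu, hT.parent_root]
      · exact Or.inl (by simp [hu, h])
    · by_cases hu : d v = u
      · rw [hu] at h
        simp [h, hu, hT.parent_root]
      · exact Or.inr (Or.inl (by simp [hu, h]))
    · simp [h]

/-- If `x` cannot hang below `y` as a leaf, it has a neighbour `p` that is the parent or a sibling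
of `y`. Then the walk `x`, `p`, `d y`, `q` of length at most 3 forces `y` to be adjacent to every
other neighbour `q` of `d y`. This is possible only if `d y` is the root, and then `y` can replace
it. -/
theorem DismantlableSet.exists_siblingTree {G : SimpleGraph V} {s : ℕ∞} (hs : 3 ≤ s) {X : Set V}
    (h : DismantlableSet G s X) : ∃ u d ρ, IsSiblingTree G X u d ρ := by
  induction h with
  | singleton x =>
    refine ⟨x, id, fun _ => 0, rfl, rfl, fun _ h => h, fun v hv hne => absurd hv hne,
      fun v hv hne => absurd hv hne, ?_⟩
    rintro v rfl w rfl h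
    exact absurd h (G.irrefl)
  | @delete X x y hx hy hxy h hX ih =>
    obtain ⟨u, d, ρ, hT⟩ := ih
    have hs1 : (1 : ℕ∞) ≤ s := le_trans (by norm_num) hs
    have hadj : G.Adj x y := by
      rcases mem_ball_one.1 (h ⟨mem_puncturedBall_self hxy, hx⟩) with h | h
      · exact absurd h hxy
      · exact h.symm
    have hnear : ∀ z ∈ X, z ∈ puncturedBall G s x y → G.Adj y z := fun z hzX hz =>
      (mem_ball_one.1 (h ⟨hz, hzX⟩)).resolve_left (ne_of_mem_puncturedBall hz)
    have hnbr : ∀ p ∈ X, G.Adj x p → p = y ∨ G.Adj y p := by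
      intro p hp hxp
      by_cases hpy : p = y
      · exact Or.inl hpy
      · exact Or.inr (hnear p hp (mem_puncturedBall_of_adj hs1 hxp hxy hpy))
    by_cases hleaf : ∀ p ∈ X, G.Adj x p → p = y ∨ d p = y
    · exact ⟨_, _, _, hT.insert_leaf hx hy hadj hleaf⟩
    push Not at hleaf
    obtain ⟨p, hp, hxp, hpy, hdp⟩ := hleaf
    have hyX : y ∈ X \ {x} := ⟨hy, hxy.symm⟩
    have hpX : p ∈ X \ {x} := ⟨hp, hxp.ne'⟩
    have hyp : G.Adj y p := (hnbr p hp hxp).resolve_left hpy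
    have hpd : p = d y ∨ d p = d y := by
      rcases hT.edge y hyX p hpX hyp with h | h | h
      · exact absurd h.symm hdp
      · exact Or.inl h
      · exact Or.inr h.symm
    have hyu : y ≠ u := by
      rintro rfl
      rw [hT.parent_root] at hpd
      exact hpd.elim hpy hdp
    have hyd : G.Adj y (d y) := hT.adj_parent y hyX hyu
    -- the neighbours of the parent of `y` are within distance `3` of `x`
    have hfar : ∀ q ∈ X, G.Adj (d y) q → q ≠ y → G.Adj y q := by
      intro q hq hdq hqy
      refine hnear q hq ?_
      by_cases hpa : p = d y
      · rw [← hpa] at hdq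
        refine ⟨.cons hxp hdq.toWalk, le_trans ?_ hs, ?_⟩
        · simp only [SimpleGraph.Walk.length_cons]
          norm_num
        · simp [hxy.symm, Ne.symm hpy, hqy.symm]
      · have hda := hpd.resolve_left hpa
        have hpu : p ≠ u := by
          rintro rfl
          exact hpa (hT.parent_root.symm.trans hda)
        have hpa' : G.Adj p (d y) := hda ▸ hT.adj_parent p hpX hpu
        refine ⟨.cons hxp (.cons hpa' hdq.toWalk), le_trans ?_ hs, ?_⟩
        · simp only [SimpleGraph.Walk.length_cons]
          norm_num
        · simp [hxy.symm, Ne.symm hpy, hqy.symm, hyd.ne]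
    have haX := hT.parent_mem y hyX
    have hρy := hT.rank_lt y hyX hyu
    -- Otherwise `y` would be adjacent to its grandparent, and the ranks rule out all three kinds of
    -- edge.
    have hau : d y = u := by
      by_contra hau
      have hρ := hT.rank_lt _ haX hau
      have hgX := hT.parent_mem _ haX
      have hgy : d (d y) ≠ y := by
        intro h
        rw [h] at hρ
        omega
      rcases hT.edge y hyX _ hgX (hfar _ hgX.1 (hT.adj_parent _ haX hau) hgy) with h | h | h
      · by_cases hgu : d (d y) = u
        · rw [hgu, hT.parent_root] at h
          exact hyu h
        · have := hT.rank_lt _ hgX hgu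
          rw [← h] at this
          omega
      · rw [h] at hρ
        omega
      · by_cases hgu : d (d y) = u
        · rw [hgu, hT.parent_root] at h
          exact hau h
        · have := hT.rank_lt _ hgX hgu
          rw [← h] at this
          omega
    refine ⟨_, _, _, hT.insert_reroot hy hadj hyu hau ?_ hnbr⟩
    intro q hq hqx hdq hqy
    by_cases hqu : q = u
    · rw [hqu, ← hau]
      exact hyd.symm
    · refine (hfar q hq ?_ hqy).symm
      rw [hau, ← hdq]
      exact (hT.adj_parent q ⟨hq, hqx⟩ hqu).symm

/-- Once a walk that avoids `y` is among the descendants of `y`, it stays there. -/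
theorem IsSiblingTree.descendant_of_adj {G : SimpleGraph V} {u : V} {d : V → V} {ρ : V → ℕ}
    (hT : IsSiblingTree G Set.univ u d ρ) {y v w : V} (hv : v ≠ y) (hvw : G.Adj v w)
    (h : ∃ n, d^[n] v = y) : ∃ n, d^[n] w = y := by
  obtain ⟨n, hn⟩ := h
  cases n with
  | zero => exact absurd hn hv
  | succ n =>
    rw [Function.iterate_succ_apply] at hn
    rcases hT.edge v trivial w trivial hvw with h | h | h
    · refine ⟨n + 2, ?_⟩
      rw [Function.iterate_succ_apply, Function.iterate_succ_apply, ← h, hn]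
    · exact ⟨n, h ▸ hn⟩
    · refine ⟨n + 1, ?_⟩
      rw [Function.iterate_succ_apply, ← h, hn]

theorem IsSiblingTree.descendant_of_walk {G : SimpleGraph V} {u : V} {d : V → V} {ρ : V → ℕ}
    (hT : IsSiblingTree G Set.univ u d ρ) {y v w : V} (p : G.Walk v w) (hy : y ∉ p.support)
    (h : ∃ n, d^[n] v = y) : ∃ n, d^[n] w = y := by
  induction p with
  | nil => exact h
  | cons hadj q ih =>
    rw [SimpleGraph.Walk.support_cons, List.mem_cons, not_or] at hy
    exact ih hy.2 (hT.descendant_of_adj (Ne.symm hy.1) hadj h)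

theorem IsSiblingTree.rank_iterate_le {G : SimpleGraph V} {u : V} {d : V → V} {ρ : V → ℕ}
    (hT : IsSiblingTree G Set.univ u d ρ) (n : ℕ) (v : V) : ρ (d^[n] v) ≤ ρ v := by
  induction n generalizing v with
  | zero => exact le_rfl
  | succ n ih =>
    rw [Function.iterate_succ_apply]
    refine (ih _).trans ?_
    by_cases hv : v = u
    · rw [hv, hT.parent_root]
    · exact (hT.rank_lt v trivial hv).le

theorem IsSiblingTree.rank_iterate_lt {G : SimpleGraph V} {u : V} {d : V → V} {ρ : V → ℕ}
    (hT : IsSiblingTree G Set.univ u d ρ) {n : ℕ} {v : V} (h : d^[n] v ≠ v) :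
    ρ (d^[n] v) < ρ v := by
  cases n with
  | zero => exact absurd rfl h
  | succ n =>
    rw [Function.iterate_succ_apply] at h ⊢
    by_cases hv : v = u
    · rw [hv, hT.parent_root, Function.iterate_fixed hT.parent_root] at h
      exact absurd rfl h
    · exact (hT.rank_iterate_le n _).trans_lt (hT.rank_lt v trivial hv)

/-- Delete a vertex `x` whose parent has maximal rank. Walks from `x` avoiding `d x` stay below `d
x`, and by maximality the vertices of `X` there are children of `d x`. Maximality also leaves `x`
without children in `X`, so `X \ {x}` stays closed under `d`. -/
theorem IsSiblingTree.dismantlableSet [Finite V] {G : SimpleGraph V} {u : V} {d : V → V}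
    {ρ : V → ℕ} (hT : IsSiblingTree G Set.univ u d ρ) (s : ℕ∞) :
    ∀ (n : ℕ) (X : Set V), X.ncard = n → u ∈ X → (∀ v ∈ X, d v ∈ X) → DismantlableSet G s X := by
  intro n
  induction n with
  | zero =>
    intro X hn hu
    rw [(Set.ncard_eq_zero).1 hn] at hu
    exact absurd hu (Set.notMem_empty u)
  | succ n ih =>
    intro X hn hu hX
    by_cases hne : (X \ {u}).Nonempty
    · obtain ⟨x, ⟨hxX, hxu⟩, hmax⟩ :=
        Set.exists_max_image (X \ {u}) (fun v => ρ (d v)) (Set.toFinite _) hne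
      have hxu : x ≠ u := hxu
      have hadj := hT.adj_parent x trivial hxu
      refine .delete hxX (hX x hxX) hadj.ne ?_ (ih _ ?_ ⟨hu, hxu.symm⟩ ?_)
      · rintro z ⟨⟨p, -, hp⟩, hzX⟩
        have hzy : z ≠ d x := fun h => hp (h ▸ p.end_mem_support)
        obtain ⟨m, hm⟩ := hT.descendant_of_walk p hp ⟨1, rfl⟩
        have hzu : z ≠ u := by
          rintro rfl
          rw [Function.iterate_fixed hT.parent_root] at hm
          exact hzy hm
        have hdz : d z = d x := by
          by_contra hne
          cases m with
          | zero => exact hzy hm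
          | succ m =>
            rw [Function.iterate_succ_apply] at hm
            have := hT.rank_iterate_lt (n := m) (v := d z) (by rw [hm]; exact Ne.symm hne)
            rw [hm] at this
            exact absurd (hmax z ⟨hzX, hzu⟩) (not_le.2 this)
        rw [mem_ball_one, ← hdz]
        exact Or.inr (hT.adj_parent z trivial hzu).symm
      · rw [Set.ncard_sdiff_singleton_of_mem hxX, hn, Nat.add_sub_cancel]
      · rintro v ⟨hvX, hvx⟩
        refine ⟨hX v hvX, fun hvd => ?_⟩
        have hvd : d v = x := hvd
        have hvu : v ≠ u := by
          rintro rfl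
          exact hxu (hvd.symm.trans hT.parent_root)
        have h₁ := hmax v ⟨hvX, hvu⟩
        have h₂ := hT.rank_lt x trivial hxu
        simp only [hvd] at h₁
        omega
    · have : X = {u} := by
        refine Set.eq_singleton_iff_unique_mem.2 ⟨hu, fun v hv => ?_⟩
        by_contra hvu
        exact hne ⟨v, hv, hvu⟩
      rw [this]
      exact .singleton u

/-! ### Blocks -/

theorem forall_of_preconnected {G : SimpleGraph V} {S : Set V} (hS : (G.induce S).Preconnected)
    {P : V → Prop} (hP : ∀ v ∈ S, ∀ w ∈ S, G.Adj v w → P v → P w) {x : V} (hx : x ∈ S)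
    (hPx : P x) : ∀ z ∈ S, P z := by
  intro z hz
  obtain ⟨p⟩ := hS ⟨x, hx⟩ ⟨z, hz⟩
  have key : ∀ {a b : S} (_ : (G.induce S).Walk a b), P a → P b := by
    intro a b p
    induction p with
    | nil => exact id
    | @cons a c b h q ih => exact fun ha => ih (hP a a.2 c c.2 h ha)
  exact key p hPx

theorem preconnected_of_star {G : SimpleGraph V} {S : Set V} {a : V} (ha : Dominates G a S) :
    (G.induce S).Preconnected := by
  have key : ∀ x : S, (G.induce S).Reachable ⟨a, ha.1⟩ x := by
    rintro ⟨x, hx⟩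
    by_cases hxa : x = a
    · subst hxa
      exact .refl _
    · exact SimpleGraph.Adj.reachable (G := G.induce S) (ha.2 x hx hxa)
  exact fun x y => (key x).symm.trans (key y)

theorem preconnected_of_subsingleton {G : SimpleGraph V} {S : Set V} (h : S.Subsingleton) :
    (G.induce S).Preconnected := by
  rintro ⟨x, hx⟩ ⟨y, hy⟩
  obtain rfl := h hx hy
  exact .refl _

theorem Nonseparable.nonempty {G : SimpleGraph V} {B : Set V} (h : Nonseparable G B) :
    B.Nonempty :=
  Set.nonempty_coe_sort.1 h.1.nonempty

theorem Nonseparable.preconnected_diff {G : SimpleGraph V} {B : Set V} (h : Nonseparable G B)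
    (v : V) : (G.induce (B \ {v})).Preconnected := by
  by_cases hv : v ∈ B
  · exact h.2 v hv
  · rw [Set.sdiff_singleton_eq_self hv]
    exact h.1.preconnected

theorem nonseparable_of_dominates {G : SimpleGraph V} {S : Set V} {a : V} (ha : Dominates G a S)
    (h : (G.induce (S \ {a})).Preconnected) : Nonseparable G S := by
  have : Nonempty S := ⟨⟨a, ha.1⟩⟩
  refine ⟨⟨preconnected_of_star ha⟩, fun v _ => ?_⟩
  by_cases hva : v = a
  · exact hva ▸ h
  · exact preconnected_of_star (a := a)
      ⟨⟨ha.1, Ne.symm hva⟩, fun w hw hwa => ha.2 w hw.1 hwa⟩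

theorem nonseparable_singleton (G : SimpleGraph V) (v : V) : Nonseparable G {v} :=
  nonseparable_of_dominates (a := v) ⟨rfl, fun _ hw hne => absurd hw hne⟩
    (preconnected_of_subsingleton (Set.subsingleton_singleton.anti Set.sdiff_subset))

theorem nonseparable_pair {G : SimpleGraph V} {v w : V} (h : G.Adj v w) :
    Nonseparable G {v, w} := by
  refine nonseparable_of_dominates (a := v) ⟨Or.inl rfl, ?_⟩ (preconnected_of_subsingleton ?_)
  · rintro x (rfl | rfl) hx
    · exact absurd rfl hx
    · exact h
  · rintro x ⟨hx | hx, hxv⟩ y ⟨hy | hy, hyv⟩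
    · exact absurd hx hxv
    · exact absurd hx hxv
    · exact absurd hy hyv
    · exact hx.trans hy.symm

theorem Nonseparable.union {G : SimpleGraph V} {B C : Set V} (hB : Nonseparable G B)
    (hC : Nonseparable G C) (h : (B ∩ C).Nontrivial) : Nonseparable G (B ∪ C) := by
  refine ⟨SimpleGraph.induce_union_connected hB.1.preconnected hC.1.preconnected h.nonempty,
    fun v _ => ?_⟩
  rw [Set.union_sdiff_distrib]
  obtain ⟨x, hx, hxv⟩ := h.exists_ne v
  exact (SimpleGraph.induce_union_connected (hB.preconnected_diff v) (hC.preconnected_diff v)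
    ⟨x, ⟨hx.1, hxv⟩, ⟨hx.2, hxv⟩⟩).preconnected

theorem Block.eq_of_nontrivial_inter {G : SimpleGraph V} {B C : Block G}
    (h : (B.1 ∩ C.1).Nontrivial) : B = C := by
  have hBC := B.2.1.union C.2.1 h
  refine Subtype.ext (subset_antisymm ?_ ?_)
  · exact Set.subset_union_left.trans (C.2.2 hBC Set.subset_union_right)
  · exact Set.subset_union_right.trans (B.2.2 hBC Set.subset_union_left)

theorem Block.inter_subsingleton {G : SimpleGraph V} {B C : Block G} (h : B ≠ C) :
    (B.1 ∩ C.1).Subsingleton :=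
  Set.not_nontrivial_iff.1 fun hBC => h (Block.eq_of_nontrivial_inter hBC)

theorem Nonseparable.exists_block [Finite V] {G : SimpleGraph V} {S : Set V}
    (h : Nonseparable G S) : ∃ B : Block G, S ⊆ B.1 := by
  obtain ⟨B, hSB, hB⟩ := Set.Finite.exists_le_maximal (Set.toFinite {B | Nonseparable G B}) h
  exact ⟨⟨B, hB⟩, hSB⟩

/-- A path between two vertices of a block stays in the block. -/
theorem Block.support_subset {G : SimpleGraph V} (B : Block G) {a z : V} (ha : a ∈ B.1)
    (hz : z ∈ B.1) {p : G.Walk a z} (hp : p.IsPath) :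
    {t | t ∈ p.support} ⊆ B.1 := by
  have main : ∀ v, (G.induce ((B.1 ∪ {t | t ∈ p.support}) \ {v})).Preconnected := by
    intro v
    set S := (B.1 ∪ {t | t ∈ p.support}) \ {v} with hS
    have hBS : B.1 \ {v} ⊆ S := Set.sdiff_subset_sdiff_left Set.subset_union_left
    have inB : ∀ (x y : V) (hx : x ∈ B.1 \ {v}) (hy : y ∈ B.1 \ {v}),
        (G.induce S).Reachable ⟨x, hBS hx⟩ ⟨y, hBS hy⟩ := fun x y hx hy =>
      (B.2.1.preconnected_diff v ⟨x, hx⟩ ⟨y, hy⟩).map (SimpleGraph.induceHomOfLE G hBS).toHom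
    have toB : ∀ x : S, ∃ (y : V) (hy : y ∈ B.1 \ {v}),
        (G.induce S).Reachable x ⟨y, hBS hy⟩ := by
      rintro ⟨x, hx⟩
      rcases hx with ⟨hx | hx, hxv⟩
      · exact ⟨x, ⟨hx, hxv⟩, .refl _⟩
      have hxv : x ≠ v := hxv
      -- A path visits `v` at most once, so one of its two halves at `x` avoids `v` and leads to the
      -- block.
      obtain ⟨q, r, -, -, hqr⟩ := hp.mem_support_iff_exists_append.1 hx
      subst hqr
      by_cases hvq : v ∈ q.support
      · have hvr : v ∉ r.support := fun hvr =>
          hp.ne_of_mem_support_of_append (Ne.symm hxv) hvq hvr rfl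
        have hsub : ∀ t ∈ r.support, t ∈ S := fun t ht =>
          ⟨Or.inr ((SimpleGraph.Walk.mem_support_append_iff _ _).2 (Or.inr ht)), fun h => hvr (h ▸ ht)⟩
        exact ⟨z, ⟨hz, fun h => hvr (h ▸ r.end_mem_support)⟩, ⟨r.induce S hsub⟩⟩
      · have hsub : ∀ t ∈ q.support, t ∈ S := fun t ht =>
          ⟨Or.inr ((SimpleGraph.Walk.mem_support_append_iff _ _).2 (Or.inl ht)), fun h => hvq (h ▸ ht)⟩
        exact ⟨a, ⟨ha, fun h => hvq (h ▸ q.start_mem_support)⟩,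
          SimpleGraph.Reachable.symm ⟨q.induce S hsub⟩⟩
    intro x y
    obtain ⟨x', hx', hxx'⟩ := toB x
    obtain ⟨y', hy', hyy'⟩ := toB y
    exact hxx'.trans ((inB x' y' hx' hy').trans hyy'.symm)
  have hconn : (G.induce (B.1 ∪ {t | t ∈ p.support})).Connected :=
    SimpleGraph.induce_union_connected B.2.1.1.preconnected p.connected_induce_support.preconnected
      ⟨a, ha, p.start_mem_support⟩
  exact Set.subset_union_right.trans
    (B.2.2 (y := B.1 ∪ {t | t ∈ p.support}) ⟨hconn, fun v _ => main v⟩ Set.subset_union_left)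

/-- The graph of the edges of `G` that do not lie in `C`. -/
def edgesOutside (G : SimpleGraph V) (C : Set V) : SimpleGraph V where
  Adj v w := G.Adj v w ∧ ¬ (v ∈ C ∧ w ∈ C)
  symm := ⟨fun _ _ h => ⟨h.1.symm, fun h' => h.2 h'.symm⟩⟩
  loopless := ⟨fun _ h => h.1.ne rfl⟩

/-- A path joining them would stay in `C`, so its first edge would lie in `C`. -/
theorem Block.not_reachable_edgesOutside {G : SimpleGraph V} (C : Block G) {a z : V}
    (ha : a ∈ C.1) (hz : z ∈ C.1) (haz : a ≠ z) : ¬ (edgesOutside G C.1).Reachable a z := by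
  intro h
  have hle : edgesOutside G C.1 ≤ G := fun _ _ h => h.1
  obtain ⟨p, hp⟩ := h.exists_isPath
  have hsub := C.support_subset ha hz (p := p.mapLe hle) (hp.mapLe hle)
  cases p with
  | nil => exact haz rfl
  | cons hadj q => exact hadj.2 ⟨ha, hsub (by simp)⟩

theorem Block.reachable_edgesOutside {G : SimpleGraph V} {Q C : Block G} (h : Q ≠ C) {x y : V}
    (hx : x ∈ Q.1) (hy : y ∈ Q.1) : (edgesOutside G C.1).Reachable x y := by
  refine forall_of_preconnected Q.2.1.1.preconnected (P := (edgesOutside G C.1).Reachable x)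
    (fun v hv w hw hvw hxv => hxv.trans (SimpleGraph.Adj.reachable ⟨hvw, fun hC => ?_⟩)) hx
    (.refl _) y hy
  exact hvw.ne (Block.inter_subsingleton h ⟨hv, hC.1⟩ ⟨hw, hC.2⟩)

/-! ### Sibling trees are big brother graphs -/

/-- If no vertex of `B` has its parent in `B` as a different vertex, all edges of `B` join siblings
and `d` is constant. Otherwise let `d w` be such a parent: the rest of `B` is connected, and an edge
leading further down to a child of some `p` would, by the same argument at `p`, place `d w` below
its own child. -/
theorem IsSiblingTree.exists_parent_of_nonseparable {G : SimpleGraph V} {u : V} {d : V → V}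
    {ρ : V → ℕ} (hT : IsSiblingTree G Set.univ u d ρ) {B : Set V} (hB : Nonseparable G B) :
    ∃ a, ∀ v ∈ B, v = a ∨ d v = a := by
  by_cases hpar : ∃ w ∈ B, d w ∈ B ∧ d w ≠ w
  · have descendants : ∀ w ∈ B, d w ∈ B → d w ≠ w → ∀ z ∈ B \ {d w}, ∃ n, d^[n] z = d w := by
      intro w hw hdw hne
      exact forall_of_preconnected (hB.preconnected_diff (d w))
        (fun v hv v' _ hvv' => hT.descendant_of_adj hv.2 hvv') ⟨hw, hne.symm⟩ ⟨1, rfl⟩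
    obtain ⟨w, hw, hdw, hne⟩ := hpar
    refine ⟨d w, fun v hv => ?_⟩
    by_cases hvd : v = d w
    · exact Or.inl hvd
    refine Or.inr (forall_of_preconnected (hB.preconnected_diff (d w)) (P := fun v => d v = d w)
      ?_ ⟨hw, hne.symm⟩ rfl v ⟨hv, hvd⟩)
    rintro p ⟨hp, hpd⟩ q ⟨hq, hqd⟩ hpq hdp
    rcases hT.edge p trivial q trivial hpq with h | h | h
    · obtain ⟨n, hn⟩ := descendants q hq (h ▸ hp) (h ▸ hpq.ne) (d w) ⟨hdw, fun h' => hpd (by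
        rw [h]; exact h'.symm)⟩
      rw [← h] at hn
      have hlt := hT.rank_iterate_lt (n := n) (v := d w) (by rw [hn]; exact hpd)
      rw [hn] at hlt
      have hle := hT.rank_iterate_le 1 p
      rw [Function.iterate_one, hdp] at hle
      omega
    · exact absurd (h.trans hdp) hqd
    · exact h.symm.trans hdp
  · push Not at hpar
    obtain ⟨x, hx⟩ := hB.nonempty
    refine ⟨d x, fun v hv => Or.inr (forall_of_preconnected hB.1.preconnected
      (P := fun v => d v = d x) ?_ hx rfl v hv)⟩
    intro p hp q hq hpq hdp
    rcases hT.edge p trivial q trivial hpq with h | h | h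
    · exact absurd (h.trans (hpar q hq (h ▸ hp))) hpq.ne
    · exact absurd (h.trans (hpar p hp (h ▸ hq))) hpq.ne'
    · exact h.symm.trans hdp

theorem IsSiblingTree.adj_of_parent_eq {G : SimpleGraph V} {u : V} {d : V → V}
    {ρ : V → ℕ} (hT : IsSiblingTree G Set.univ u d ρ) {a v : V} (hva : v ≠ a) (hd : d v = a) :
    G.Adj a v := by
  rw [← hd]
  refine (hT.adj_parent v trivial ?_).symm
  rintro rfl
  exact hva (hT.parent_root.symm.trans hd)

/-- Adding a common parent from outside would keep `B` nonseparable, against maximality. -/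
theorem IsSiblingTree.exists_top {G : SimpleGraph V} {u : V} {d : V → V} {ρ : V → ℕ}
    (hT : IsSiblingTree G Set.univ u d ρ) (B : Block G) :
    ∃ a ∈ B.1, ∀ v ∈ B.1, v = a ∨ d v = a := by
  obtain ⟨a, ha⟩ := hT.exists_parent_of_nonseparable B.2.1
  refine ⟨a, ?_, ha⟩
  by_contra haB
  have hdom : Dominates G a (insert a B.1) := by
    refine ⟨Set.mem_insert _ _, fun v hv hva => ?_⟩
    have hvB := hv.resolve_left hva
    exact hT.adj_of_parent_eq hva ((ha v hvB).resolve_left hva)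
  have hns : Nonseparable G (insert a B.1) := by
    refine nonseparable_of_dominates hdom ?_
    rw [Set.insert_sdiff_self_of_notMem haB]
    exact B.2.1.1.preconnected
  exact haB (B.2.2 hns (Set.subset_insert _ _) (Set.mem_insert _ _))

theorem IsSiblingTree.connected {G : SimpleGraph V} {u : V} {d : V → V} {ρ : V → ℕ}
    (hT : IsSiblingTree G Set.univ u d ρ) : G.Connected := by
  have key : ∀ n v, ρ v = n → G.Reachable v u := by
    intro n
    induction n using Nat.strong_induction_on with
    | _ n ih =>
      rintro v rfl
      by_cases hv : v = u
      · rw [hv]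
      · exact (hT.adj_parent v trivial hv).reachable.trans
          (ih _ (hT.rank_lt v trivial hv) (d v) rfl)
  have : Nonempty V := ⟨u⟩
  exact ⟨fun v w => (key _ v rfl).trans (key _ w rfl).symm⟩

theorem blockGraph_connected [Finite V] {G : SimpleGraph V} (hG : G.Connected) :
    (blockGraph G).Connected := by
  have meet : ∀ B C : Block G, (B.1 ∩ C.1).Nonempty → (blockGraph G).Reachable B C := by
    intro B C h
    by_cases hBC : B = C
    · rw [hBC]
    · exact SimpleGraph.Adj.reachable ⟨hBC, h⟩
  have walk : ∀ (v w : V) (_ : G.Walk v w) (B C : Block G), v ∈ B.1 → w ∈ C.1 →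
      (blockGraph G).Reachable B C := by
    intro v w p
    induction p with
    | nil => exact fun B C hB hC => meet B C ⟨_, hB, hC⟩
    | cons h q ih =>
      intro B C hB hC
      obtain ⟨D, hD⟩ := (nonseparable_pair h).exists_block
      exact (meet B D ⟨_, hB, hD (Or.inl rfl)⟩).trans (ih D C (hD (Or.inr rfl)) hC)
  obtain ⟨v⟩ := hG.nonempty
  obtain ⟨B₀, -⟩ := (nonseparable_singleton G v).exists_block
  have : Nonempty (Block G) := ⟨B₀⟩
  refine ⟨fun B C => ?_⟩
  obtain ⟨x, hx⟩ := B.2.1.nonempty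
  obtain ⟨y, hy⟩ := C.2.1.nonempty
  obtain ⟨p⟩ := hG.preconnected x y
  exact walk x y p B C hx hy

/-- Blocks below `c` can be reached from other blocks only through the block that contains `c` and
its parent. -/
theorem Block.mem_support_of_walk {G : SimpleGraph V} {d : V → V} {B : Block G} {c : V}
    (hcB : c ∈ B.1) (hdB : d c ∈ B.1)
    (hc : c ≠ d c) {top : Block G → V} (htop : ∀ Q, top Q ∈ Q.1)
    (hchild : ∀ Q : Block G, ∀ v ∈ Q.1, v = top Q ∨ d v = top Q) {Q P : Block G}
    (p : (blockGraph G).Walk Q P) (hQ : ¬ ∃ n, d^[n] (top Q) = c) (hP : ∃ n, d^[n] (top P) = c) :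
    B ∈ p.support := by
  induction p with
  | nil => exact absurd hP hQ
  | @cons Q Q' P h q ih =>
    by_cases hQ' : ∃ n, d^[n] (top Q') = c
    -- Here the walk enters the part below `c`: `w` lies below `c` but its parent `top Q` does not,
    -- so `w = c`, and `Q` shares both `c` and `d c` with `B`.
    · obtain ⟨w, hwQ, hwQ'⟩ := h.2
      have hw : ∃ n, d^[n] w = c := by
        rcases hchild Q' w hwQ' with h | h
        · exact h ▸ hQ'
        · obtain ⟨n, hn⟩ := hQ'
          exact ⟨n + 1, by rw [Function.iterate_succ_apply, h, hn]⟩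
      have hwt : w ≠ top Q := fun h => hQ (h ▸ hw)
      have hdw : d w = top Q := (hchild Q w hwQ).resolve_left hwt
      obtain ⟨n, hn⟩ := hw
      cases n with
      | zero =>
        have hwc : w = c := hn
        subst hwc
        have : Q = B := Block.eq_of_nontrivial_inter
          ⟨w, ⟨hwQ, hcB⟩, d w, ⟨hdw ▸ htop Q, hdB⟩, hc⟩
        exact this ▸ SimpleGraph.Walk.start_mem_support _
      | succ n =>
        rw [Function.iterate_succ_apply, hdw] at hn
        exact absurd ⟨n, hn⟩ hQ
    · exact List.mem_cons_of_mem _ (ih hQ' hP)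

/-- Root the blocks at one containing `u`. If a father `P` met `B` in a vertex `c` other than the
top of `B`, then `P` would hang below `c`, and a shortest walk from the root to `P` would pass
through `B`, so `B` would not be farther away. -/
theorem IsSiblingTree.isBigBrother [Finite V] {G : SimpleGraph V} {u : V} {d : V → V} {ρ : V → ℕ}
    (hT : IsSiblingTree G Set.univ u d ρ) : IsBigBrother G := by
  classical
  choose top htop hchild using hT.exists_top
  have hdom : ∀ B : Block G, Dominates G (top B) B.1 := fun B =>
    ⟨htop B, fun v hv hva => hT.adj_of_parent_eq hva ((hchild B v hv).resolve_left hva)⟩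
  have hconn := blockGraph_connected hT.connected
  obtain ⟨R, hR⟩ := (nonseparable_singleton G u).exists_block
  have htopR : top R = u := by
    rcases hchild R u (hR rfl) with h | h
    · exact h.symm
    · exact h.symm.trans hT.parent_root
  refine ⟨hconn, fun B => ⟨_, hdom B⟩, R, fun P B hPB => ?_⟩
  obtain ⟨⟨hne, c, hcP, hcB⟩, hdist⟩ := hPB
  have hsub := Block.inter_subsingleton hne
  refine ⟨c, hsub.eq_singleton_of_mem ⟨hcP, hcB⟩, ?_⟩
  suffices hc : c = top B from hc ▸ hdom B
  by_contra hc
  have hdc : d c = top B := (hchild B c hcB).resolve_left hc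
  have hcd : c ≠ d c := hdc ▸ hc
  have htopP : top P = c := by
    rcases hchild P c hcP with h | h
    · exact h.symm
    · have hBP : top B ∈ P.1 := by
        rw [← hdc, h]
        exact htop P
      exact absurd (hsub ⟨hcP, hcB⟩ ⟨hBP, htop B⟩) hc
  obtain ⟨p, hp⟩ := hconn.exists_walk_length_eq_dist R P
  have hmem : B ∈ p.support := by
    refine Block.mem_support_of_walk hcB (hdc ▸ htop B) hcd htop hchild p ?_ ⟨0, htopP⟩
    rintro ⟨n, hn⟩
    rw [htopR, Function.iterate_fixed hT.parent_root] at hn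
    rw [← hn, hT.parent_root] at hcd
    exact hcd rfl
  have h₁ := SimpleGraph.dist_le (p.takeUntil B hmem)
  have h₂ := p.length_takeUntil_le_length hmem
  omega

/-! ### Big brother graphs are sibling trees -/

theorem exists_adj_dist_eq {W : Type*} {H : SimpleGraph W} (hH : H.Connected) {r b : W} {n : ℕ}
    (h : H.dist r b = n + 1) : ∃ p, H.Adj p b ∧ H.dist r p = n := by
  obtain ⟨q, hq⟩ := hH.exists_walk_length_eq_dist b r
  rw [SimpleGraph.dist_comm, h] at hq
  cases q with
  | nil => simp at hq
  | @cons _ p _ hadj q =>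
    refine ⟨p, hadj.symm, ?_⟩
    have h₁ : H.dist r p ≤ q.length := by
      rw [SimpleGraph.dist_comm]
      exact SimpleGraph.dist_le q
    have h₂ := hH.dist_triangle (u := r) (v := p) (w := b)
    have h₃ : H.dist p b = 1 := SimpleGraph.dist_eq_one_iff_adj.2 hadj.symm
    simp only [SimpleGraph.Walk.length_cons] at hq
    omega

/-- A block `C` other than the root meets the blocks that are at most as far from the root in at
most one vertex. -/
theorem eq_of_mem_block_of_dist_le {G : SimpleGraph V} (hconn : (blockGraph G).Connected)
    {R C : Block G} (hC : C ≠ R) {a z : V} (ha : a ∈ C.1) (hz : z ∈ C.1)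
    (ha' : ∃ Q, Q ≠ C ∧ (blockGraph G).dist R Q ≤ (blockGraph G).dist R C ∧ a ∈ Q.1)
    (hz' : ∃ Q, Q ≠ C ∧ (blockGraph G).dist R Q ≤ (blockGraph G).dist R C ∧ z ∈ Q.1) : a = z := by
  obtain ⟨r, hr⟩ := R.2.1.nonempty
  -- Stepping from `Q` to ever closer blocks never uses `C`, since all later distances are below
  -- that of `C`.
  have reach : ∀ n (Q : Block G), (blockGraph G).dist R Q = n → n ≤ (blockGraph G).dist R C →
      Q ≠ C → ∀ x ∈ Q.1, (edgesOutside G C.1).Reachable r x := by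
    intro n
    induction n with
    | zero =>
      intro Q hQ _ hQC x hx
      rw [hconn.dist_eq_zero_iff] at hQ
      exact Block.reachable_edgesOutside hQC (hQ ▸ hr) hx
    | succ n ih =>
      intro Q hQ hn hQC x hx
      obtain ⟨P, ⟨-, y, hyP, hyQ⟩, hdist⟩ := exists_adj_dist_eq hconn hQ
      have hPC : P ≠ C := by
        rintro rfl
        omega
      exact (ih P hdist (by omega) hPC y hyP).trans (Block.reachable_edgesOutside hQC hyQ hx)
  obtain ⟨Q, hQC, hQ, haQ⟩ := ha'
  obtain ⟨Q', hQC', hQ', hzQ⟩ := hz'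
  by_contra haz
  exact C.not_reachable_edgesOutside ha hz haz
    ((reach _ Q rfl hQ hQC a haQ).symm.trans (reach _ Q' rfl hQ' hQC' z hzQ))

/-- The parent of `v` is `art (home v)`, where `home v` is a block nearest the root containing `v`.
In each block all vertices but `art C` have home `C`, so an edge inside `C` joins siblings or a
parent and child. -/
theorem IsBigBrother.exists_siblingTree [Finite V] {G : SimpleGraph V} (hG : IsBigBrother G) :
    ∃ u d ρ, IsSiblingTree G Set.univ u d ρ := by
  classical
  obtain ⟨hconn, hdom, R, hR⟩ := hG
  let lev : Block G → ℕ := (blockGraph G).dist R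
  -- the vertex that `C` shares with its father, or a dominating vertex of the root
  have hart : ∀ C : Block G, ∃ a, Dominates G a C.1 ∧
      (C ≠ R → ∃ P, P ≠ C ∧ lev P < lev C ∧ a ∈ P.1) := by
    intro C
    by_cases hC : C = R
    · obtain ⟨a, ha⟩ := hdom C
      exact ⟨a, ha, fun h => absurd hC h⟩
    · have hpos : lev C ≠ 0 := fun h => hC ((hconn.dist_eq_zero_iff).1 h).symm
      obtain ⟨n, hn⟩ := Nat.exists_eq_succ_of_ne_zero hpos
      obtain ⟨P, hadj, hdist⟩ := exists_adj_dist_eq hconn hn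
      obtain ⟨a, haP, ha⟩ := hR P C ⟨hadj, by rw [hdist]; exact hn⟩
      have : a ∈ P.1 ∩ C.1 := haP ▸ rfl
      exact ⟨a, ha, fun _ => ⟨P, hadj.1, by rw [hn]; exact Nat.lt_succ_of_le hdist.le, this.1⟩⟩
  choose art hart hfather using hart
  have hmin : ∀ v, ∃ B : Block G, v ∈ B.1 ∧ ∀ C : Block G, v ∈ C.1 → lev B ≤ lev C := by
    intro v
    obtain ⟨B₀, hB₀⟩ := (nonseparable_singleton G v).exists_block
    obtain ⟨B, hB, hmin⟩ := Set.exists_min_image {B : Block G | v ∈ B.1} lev (Set.toFinite _)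
      ⟨B₀, hB₀ rfl⟩
    exact ⟨B, hB, hmin⟩
  choose home hhome hmin using hmin
  have home_root : ∀ v ∈ R.1, home v = R := by
    intro v hv
    have h := hmin v R hv
    have h0 : lev R = 0 := SimpleGraph.dist_self
    exact ((hconn.dist_eq_zero_iff).1 (Nat.le_zero.1 (h.trans h0.le))).symm
  have home_eq : ∀ C : Block G, ∀ z ∈ C.1, z ≠ art C → home z = C := by
    intro C z hz hza
    by_cases hC : C = R
    · rw [hC] at hz ⊢
      exact home_root z hz
    by_contra hne
    obtain ⟨P, hPC, hlt, haP⟩ := hfather C hC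
    exact hza (eq_of_mem_block_of_dist_le hconn hC hz (hart C).1
      ⟨home z, hne, hmin z C hz, hhome z⟩ ⟨P, hPC, hlt.le, haP⟩)
  have hu : home (art R) = R := home_root _ (hart R).1
  have lev_art : ∀ C, C ≠ R → lev (home (art C)) < lev C := by
    intro C hC
    obtain ⟨P, -, hlt, haP⟩ := hfather C hC
    exact (hmin _ P haP).trans_lt hlt
  have art_ne : ∀ v, v ≠ art R → v ≠ art (home v) := by
    intro v hv h
    by_cases hvR : home v = R
    · exact hv (hvR ▸ h)
    · have := lev_art _ hvR
      rw [← h] at this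
      exact lt_irrefl _ this
  -- Levels alone do not separate the root from its children in `R`; the extra 1 does, and the
  -- factor 2 keeps it from spoiling a drop in level.
  refine ⟨art R, fun v => art (home v), fun v => 2 * lev (home v) + if v = art R then 0 else 1,
    trivial, by rw [hu], fun _ _ => trivial, ?_, ?_, ?_⟩
  · exact fun v _ hv => ((hart (home v)).2 v (hhome v) (art_ne v hv)).symm
  · intro v _ hv
    simp only [if_neg hv]
    by_cases hvR : home v = R
    · simp [hvR, hu]
    · have := lev_art _ hvR
      split_ifs <;> omega
  · intro v _ w _ hvw
    obtain ⟨C, hC⟩ := (nonseparable_pair hvw).exists_block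
    have hv : v ∈ C.1 := hC (Or.inl rfl)
    have hw : w ∈ C.1 := hC (Or.inr rfl)
    by_cases hva : v = art C
    · left
      rw [home_eq C w hw (hva ▸ hvw.ne'), hva]
    by_cases hwa : w = art C
    · right; left
      rw [home_eq C v hv hva, hwa]
    · right; right
      rw [home_eq C v hv hva, home_eq C w hw hwa]

end FastRobber

theorem mainTheorem3 {V : Type*} [Finite V] [Nonempty V] (G : SimpleGraph V) :
    List.TFAE [
      FastRobber.CWFR G 3,
      FastRobber.Dismantlable G 3 1,
      FastRobber.CWFR G ⊤,
      FastRobber.Dismantlable G ⊤ 1,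
      FastRobber.IsBigBrother G] ∧
    ∀ s t : ℕ∞, 3 ≤ s → 3 ≤ t → (FastRobber.CWFR G s ↔ FastRobber.CWFR G t) := by
  have tfae : List.TFAE [
      FastRobber.CWFR G 3,
      FastRobber.Dismantlable G 3 1,
      FastRobber.CWFR G ⊤,
      FastRobber.Dismantlable G ⊤ 1,
      FastRobber.IsBigBrother G] := by
    tfae_have 1 → 2 := fun h => h.dismantlable (by norm_num)
    tfae_have 2 → 5 := fun h => by
      obtain ⟨u, d, ρ, hT⟩ := h.dismantlableSet.exists_siblingTree le_rfl
      exact hT.isBigBrother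
    tfae_have 5 → 4 := fun h => by
      obtain ⟨u, d, ρ, hT⟩ := h.exists_siblingTree
      exact (hT.dismantlableSet ⊤ _ Set.univ rfl trivial fun _ _ => trivial).dismantlable
    tfae_have 4 → 3 := fun h => h.cwfr le_top
    tfae_have 3 → 1 := fun h => h.anti le_top
    tfae_finish
  have top_of : ∀ s : ℕ∞, 3 ≤ s → FastRobber.CWFR G s → FastRobber.CWFR G ⊤ :=
    fun s hs h => (tfae.out 0 2).1 (h.anti hs)
  exact ⟨tfae, fun s t hs ht =>
    ⟨fun h => (top_of s hs h).anti le_top, fun h => (top_of t ht h).anti le_top⟩⟩
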